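/- Let $H$ be a complex Hilbert space (of arbitrary dimension), and let $C_1^+(H)$ be the set of all positive self-adjoint bounded operators on $H$ with finite trace. For $A,B\in C_1^+(H)$ let $F(A,B)=\operatorname{tr}\bigl((A^{1/2}BA^{1/2})^{1/2}\bigr)$ be Uhlmann's fidelity. Let $\phi\colon C_1^+(H)\to C_1^+(H)$ be a bijective map such that $F(\phi(A),\phi(B))=F(A,B)$ for all $A,B\in C_1^+(H)$. Then there is a unitary or antiunitary operator $U\colon H\to H$ such that $\phi(A)=UAU^*$ for all $A\in C_1^+(H)$. -/

import Mathlib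

open scoped ENNReal InnerProductSpace

noncomputable section

set_option linter.unusedSectionVars false

namespace FidelityPreserving

variable {H : Type*} [NormedAddCommGroup H] [InnerProductSpace ℂ H] [CompleteSpace H]

/-- The sum `∑ i, ⟪b i, A (b i)⟫ ∈ [0, ∞]` of the diagonal entries of a positive bounded operator
`A` along the Hilbert basis `b` (the entries are nonnegative reals, as `A` is positive). -/
def traceAlong {ι : Type*} (b : HilbertBasis ι ℂ H) (A : H →L[ℂ] H) : ℝ≥0∞ :=
  ∑' i, ENNReal.ofReal (RCLike.re ⟪b i, A (b i)⟫_ℂ)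

/-- The trace, with values in `[0, ∞]`, of a positive bounded operator on a complex Hilbert space
(of any dimension). It does not depend on the Hilbert basis, see `trace_eq_traceAlong`. -/
def trace (A : H →L[ℂ] H) : ℝ≥0∞ :=
  traceAlong (exists_hilbertBasis ℂ H).choose_spec.choose A

lemma ofReal_norm_sq_eq_tsum {ι : Type*} (b : HilbertBasis ι ℂ H) (x : H) :
    ENNReal.ofReal (‖x‖ ^ 2) = ∑' i, ENNReal.ofReal (‖⟪b i, x⟫_ℂ‖ ^ 2) := by
  have h := (b.hasSum_inner_mul_inner x x).mapL Complex.reCLM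
  have h2 : HasSum (fun i => ‖⟪b i, x⟫_ℂ‖ ^ 2) (‖x‖ ^ 2) := by
    convert h using 1
    · funext i
      rw [← inner_conj_symm x (b i), Complex.conj_mul']
      simp [← Complex.ofReal_pow]
    · rw [inner_self_eq_norm_sq_to_K]
      simp [← Complex.ofReal_pow]
  rw [← h2.tsum_eq, ENNReal.ofReal_tsum_of_nonneg (fun i => by positivity) h2.summable]

lemma traceAlong_eq {ι κ : Type*} (b : HilbertBasis ι ℂ H) (c : HilbertBasis κ ℂ H)
    {A : H →L[ℂ] H} (hA : 0 ≤ A) : traceAlong b A = traceAlong c A := by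
  have hS : ∀ x y : H, ⟪CFC.sqrt A x, y⟫_ℂ = ⟪x, CFC.sqrt A y⟫_ℂ :=
    ((ContinuousLinearMap.nonneg_iff_isPositive _).1 (CFC.sqrt_nonneg A)).isSymmetric
  have hx : ∀ x : H, RCLike.re ⟪x, A x⟫_ℂ = ‖CFC.sqrt A x‖ ^ 2 := fun x => by
    conv_lhs => rw [← CFC.sqrt_mul_sqrt_self A hA]
    rw [mul_apply_eq_comp, ← hS, inner_self_eq_norm_sq]
  unfold traceAlong
  simp_rw [hx]
  rw [tsum_congr fun i => ofReal_norm_sq_eq_tsum c (CFC.sqrt A (b i)),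
    tsum_congr fun j => ofReal_norm_sq_eq_tsum b (CFC.sqrt A (c j)), ENNReal.tsum_comm]
  refine tsum_congr fun j => tsum_congr fun i => ?_
  rw [← hS, norm_inner_symm]

lemma trace_eq_traceAlong {ι : Type*} (b : HilbertBasis ι ℂ H) {A : H →L[ℂ] H} (hA : 0 ≤ A) :
    trace A = traceAlong b A :=
  traceAlong_eq _ _ hA

variable (H) in
/-- The set of density operators (not normalized): positive (in particular self-adjoint) bounded
operators with finite trace. -/
def densityOperators : Set (H →L[ℂ] H) :=
  {A | 0 ≤ A ∧ trace A < ∞}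

/-- Uhlmann's fidelity `tr (A^{1/2} B A^{1/2})^{1/2}` of positive operators. It is the trace of
a positive operator, hence takes its values in `[0, ∞]`. -/
def fidelity (A B : H →L[ℂ] H) : ℝ≥0∞ :=
  trace (CFC.sqrt (CFC.sqrt A * B * CFC.sqrt A))

/-- For an antiunitary operator `V` (a surjective antilinear isometry) the inverse `V.symm` is the
adjoint of `V`, in the sense of antilinear operators. -/
lemma inner_antiunitary_apply_left (V : H ≃ₗᵢ⋆[ℂ] H) (x y : H) :
    ⟪V x, y⟫_ℂ = starRingEnd ℂ ⟪x, V.symm y⟫_ℂ := by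
  have key : ∀ x z : H, ⟪V x, V z⟫_ℂ = ⟪z, x⟫_ℂ := fun x z => by
    have h : ∀ c : ℂ, ‖V x + c • V z‖ = ‖x + (starRingEnd ℂ c) • z‖ := fun c => by
      rw [← V.norm_map (x + _), map_add, V.map_smulₛₗ, Complex.conj_conj]
    have h1 := congrArg (· ^ 2) (h 1)
    have h2 := congrArg (· ^ 2) (h Complex.I)
    simp only [@norm_add_sq ℂ, norm_smul, inner_smul_right, V.norm_map, map_one, one_smul,
      Complex.conj_I, norm_neg, Complex.norm_I] at h1 h2
    rw [← inner_conj_symm z x]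
    apply Complex.ext
    · simp at h1
      rw [Complex.conj_re, h1]
    · simp at h2
      rw [Complex.conj_im]
      linarith
  rw [inner_conj_symm, ← key x (V.symm y), V.apply_symm_apply]

end FidelityPreserving

end

/-! Fidelity with a rank-one operator is the quadratic form: `F(|x⟩⟨x|, A) = ⟪x, A x⟫^{1/2}`
(`fidelity_dyad`). Together with monotonicity of the square root this expresses the operator order
through fidelity (`le_iff_fidelity_le`), so `φ` is an order automorphism. Rank-one operators are
exactly the nonzero elements below which the order is total (`pureState_chain`,
`exists_eq_pureState`). Hence `φ` sends `|x⟩⟨x|` to some `|T x⟩⟨T x|`, and `fidelity_dyad` gives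
`|⟪T x, T y⟫| = |⟪x, y⟫|`. Wigner's theorem (`exists_isometryEquiv_phaseEq`) replaces `T`, up to
phases, by a unitary or antiunitary `U`. Then `⟪U x, φ(A) U x⟫ = ⟪x, A x⟫` for all `x`, and a
complex quadratic form determines its operator. -/

noncomputable section

set_option linter.unusedSectionVars false

namespace FidelityPreserving

/-! ### Rank-one operators, fidelity and the operator order -/

section Operators

variable {H : Type*} [NormedAddCommGroup H] [InnerProductSpace ℂ H] [CompleteSpace H]

/-- The positive operator `|x⟩⟨x|`. -/
def dyad (x : H) : H →L[ℂ] H := InnerProductSpace.rankOne ℂ x x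

lemma dyad_apply (x y : H) : dyad x y = ⟪x, y⟫_ℂ • x := rfl

lemma dyad_nonneg (x : H) : 0 ≤ dyad x :=
  (ContinuousLinearMap.nonneg_iff_isPositive _).2 (InnerProductSpace.isPositive_rankOne_self x)

lemma dyad_ne_zero {x : H} (hx : x ≠ 0) : dyad x ≠ 0 :=
  InnerProductSpace.rankOne_ne_zero hx hx

lemma dyad_smul (c : ℂ) (x : H) : dyad (c • x) = ((‖c‖ ^ 2 : ℝ) : ℂ) • dyad x := by
  ext y
  simp only [dyad_apply, inner_smul_left, smul_smul, smul_apply]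
  congr 1
  rw [Complex.ofReal_pow, ← Complex.conj_mul']
  ring

lemma ofReal_smul_dyad {d : ℝ} (hd : 0 ≤ d) (x : H) :
    (d : ℂ) • dyad x = dyad (((√d : ℝ) : ℂ) • x) := by
  rw [dyad_smul, Complex.norm_real, Real.norm_of_nonneg (Real.sqrt_nonneg d), Real.sq_sqrt hd]

lemma re_inner_dyad (x y : H) : RCLike.re ⟪y, dyad x y⟫_ℂ = ‖⟪x, y⟫_ℂ‖ ^ 2 := by
  rw [dyad_apply, inner_smul_right, ← inner_conj_symm y x, Complex.mul_conj']
  simp [← Complex.ofReal_pow]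

lemma trace_dyad (x : H) : trace (dyad x) = ENNReal.ofReal (‖x‖ ^ 2) := by
  unfold trace traceAlong
  rw [ofReal_norm_sq_eq_tsum (exists_hilbertBasis ℂ H).choose_spec.choose]
  refine tsum_congr fun i => ?_
  rw [re_inner_dyad, norm_inner_symm]

/-- The operator `|x⟩⟨x|` as an element of the set of density operators. -/
def pureState (x : H) : densityOperators H :=
  ⟨dyad x, dyad_nonneg x, by rw [trace_dyad]; exact ENNReal.ofReal_lt_top⟩

lemma inner_sqrt {A : H →L[ℂ] H} (hA : 0 ≤ A) (x y : H) :
    ⟪x, A y⟫_ℂ = ⟪CFC.sqrt A x, CFC.sqrt A y⟫_ℂ := by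
  have hS : ∀ x y : H, ⟪CFC.sqrt A x, y⟫_ℂ = ⟪x, CFC.sqrt A y⟫_ℂ :=
    ((ContinuousLinearMap.nonneg_iff_isPositive _).1 (CFC.sqrt_nonneg A)).isSymmetric
  conv_lhs => rw [← CFC.sqrt_mul_sqrt_self A hA]
  rw [mul_apply_eq_comp, ← hS]

lemma re_inner_nonneg {A : H →L[ℂ] H} (hA : 0 ≤ A) (x : H) : 0 ≤ RCLike.re ⟪x, A x⟫_ℂ := by
  rw [inner_sqrt hA]
  exact inner_self_nonneg

lemma ofReal_re_inner {A : H →L[ℂ] H} (hA : 0 ≤ A) (x : H) :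
    ((RCLike.re ⟪x, A x⟫_ℂ : ℝ) : ℂ) = ⟪x, A x⟫_ℂ := by
  rw [inner_sqrt hA]
  exact inner_self_ofReal_re (𝕜 := ℂ) _

lemma inner_apply_symm {A : H →L[ℂ] H} (hA : 0 ≤ A) (x y : H) : ⟪A x, y⟫_ℂ = ⟪x, A y⟫_ℂ :=
  ((ContinuousLinearMap.nonneg_iff_isPositive _).1 hA).isSymmetric x y

/-- Cauchy-Schwarz for the vectors `A^{1/2} x` and `A^{1/2} y`. -/
lemma norm_inner_sq_le {A : H →L[ℂ] H} (hA : 0 ≤ A) (x y : H) :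
    ‖⟪x, A y⟫_ℂ‖ ^ 2 ≤ RCLike.re ⟪x, A x⟫_ℂ * RCLike.re ⟪y, A y⟫_ℂ := by
  rw [inner_sqrt hA, inner_sqrt hA, inner_sqrt hA, inner_self_eq_norm_sq, inner_self_eq_norm_sq,
    ← mul_pow]
  exact pow_le_pow_left₀ (norm_nonneg _) (norm_inner_le_norm _ _) 2

lemma apply_eq_zero {A : H →L[ℂ] H} (hA : 0 ≤ A) {x : H} (hx : RCLike.re ⟪x, A x⟫_ℂ = 0) :
    A x = 0 := by
  have h := norm_inner_sq_le hA (A x) x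
  rw [hx, mul_zero] at h
  have h2 : ‖⟪A x, A x⟫_ℂ‖ = 0 := by nlinarith [norm_nonneg ⟪A x, A x⟫_ℂ]
  exact inner_self_eq_zero.1 (norm_eq_zero.1 h2)

lemma le_iff_re_inner_le {A B : H →L[ℂ] H} (hA : 0 ≤ A) (hB : 0 ≤ B) :
    A ≤ B ↔ ∀ x, RCLike.re ⟪x, A x⟫_ℂ ≤ RCLike.re ⟪x, B x⟫_ℂ := by
  rw [ContinuousLinearMap.le_def, ContinuousLinearMap.isPositive_def']
  have hsa : IsSelfAdjoint (B - A) := (IsSelfAdjoint.of_nonneg hB).sub (IsSelfAdjoint.of_nonneg hA)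
  simp only [hsa, true_and, ContinuousLinearMap.reApplyInnerSelf_apply,
    sub_apply, inner_sub_left, map_sub, sub_nonneg, inner_apply_symm hA,
    inner_apply_symm hB]

lemma trace_mono {A B : H →L[ℂ] H} (hA : 0 ≤ A) (h : A ≤ B) : trace A ≤ trace B :=
  ENNReal.tsum_le_tsum fun _ =>
    ENNReal.ofReal_le_ofReal ((le_iff_re_inner_le hA (hA.trans h)).1 h _)

lemma fidelity_mono (C : H →L[ℂ] H) {A B : H →L[ℂ] H} (h : A ≤ B) :
    fidelity C A ≤ fidelity C B :=
  trace_mono (CFC.sqrt_nonneg _)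
    (CFC.sqrt_le_sqrt _ _ (conjugate_le_conjugate_of_nonneg h (CFC.sqrt_nonneg C)))

lemma dyad_comp_dyad (A : H →L[ℂ] H) (u : H) : dyad u * A * dyad u = ⟪u, A u⟫_ℂ • dyad u := by
  ext y
  simp only [mul_apply_eq_comp, dyad_apply, map_smul, smul_apply, smul_smul]
  rw [mul_comm]

lemma sqrt_smul_dyad {u : H} (hu : ‖u‖ = 1) {c : ℝ} (hc : 0 ≤ c) :
    CFC.sqrt ((c : ℂ) • dyad u) = ((√c : ℝ) : ℂ) • dyad u := by
  have hpos : ∀ d : ℝ, 0 ≤ d → 0 ≤ (d : ℂ) • dyad u := fun d hd => by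
    rw [ofReal_smul_dyad hd]
    exact dyad_nonneg _
  refine CFC.sqrt_unique ?_ (hpos _ (Real.sqrt_nonneg c))
  have h := dyad_comp_dyad 1 u
  rw [mul_one, one_apply_eq_self, inner_self_eq_norm_sq_to_K, hu] at h
  rw [smul_mul_smul_comm, h, ← Complex.ofReal_mul, Real.mul_self_sqrt hc]
  simp

/-- For `x = c • u` with `u` a unit vector, the root of `dyad x` is `c • dyad u`, so the sandwich
collapses to the multiple `c² ⟪u, A u⟫` of the projection `dyad u`. -/
lemma fidelity_dyad (x : H) {A : H →L[ℂ] H} (hA : 0 ≤ A) :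
    fidelity (dyad x) A = ENNReal.ofReal √(RCLike.re ⟪x, A x⟫_ℂ) := by
  by_cases hx : x = 0
  · subst hx
    have h0 : dyad (0 : H) = 0 := by ext; simp [dyad_apply]
    simp [fidelity, h0, trace, traceAlong]
  obtain ⟨u, hu, c, hc, rfl⟩ : ∃ u : H, ‖u‖ = 1 ∧ ∃ c : ℝ, 0 ≤ c ∧ x = (c : ℂ) • u := by
    have hx' : (‖x‖ : ℂ) ≠ 0 := by simpa using hx
    refine ⟨((‖x‖ : ℂ)⁻¹) • x, ?_, ‖x‖, norm_nonneg x, ?_⟩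
    · rw [norm_smul, norm_inv, Complex.norm_real, norm_norm, inv_mul_cancel₀ (by simpa using hx)]
    · rw [smul_smul, mul_inv_cancel₀ hx', one_smul]
  have hq : RCLike.re ⟪(c : ℂ) • u, A ((c : ℂ) • u)⟫_ℂ = c ^ 2 * RCLike.re ⟪u, A u⟫_ℂ := by
    rw [map_smul, inner_smul_left, inner_smul_right, Complex.conj_ofReal, ← ofReal_re_inner hA u,
      ← Complex.ofReal_mul, ← Complex.ofReal_mul]
    simp
    ring
  have hn : 0 ≤ c ^ 2 * RCLike.re ⟪u, A u⟫_ℂ := mul_nonneg (sq_nonneg c) (re_inner_nonneg hA u)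
  have hd : ∀ d : ℝ, 0 ≤ d → trace ((d : ℂ) • dyad u) = ENNReal.ofReal d := fun d hd => by
    rw [ofReal_smul_dyad hd, trace_dyad, norm_smul, hu, mul_one, Complex.norm_real,
      Real.norm_of_nonneg (Real.sqrt_nonneg d), Real.sq_sqrt hd]
  have hs : CFC.sqrt (dyad ((c : ℂ) • u)) = (c : ℂ) • dyad u := by
    rw [dyad_smul, sqrt_smul_dyad hu (sq_nonneg _), Complex.norm_real, Real.norm_of_nonneg hc,
      Real.sqrt_sq hc]
  have hm : (c : ℂ) • dyad u * A * ((c : ℂ) • dyad u) =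
      ((c ^ 2 * RCLike.re ⟪u, A u⟫_ℂ : ℝ) : ℂ) • dyad u := by
    rw [smul_mul_assoc, smul_mul_smul_comm, dyad_comp_dyad, smul_smul, Complex.ofReal_mul,
      ofReal_re_inner hA]
    push_cast
    ring_nf
  rw [fidelity, hs, hm, sqrt_smul_dyad hu hn, hd _ (Real.sqrt_nonneg _), hq]

/-- Conversely to monotonicity, testing on rank-one `C` already compares the quadratic forms. -/
lemma le_iff_fidelity_le (A B : densityOperators H) :
    A ≤ B ↔ ∀ C : densityOperators H, fidelity (C : H →L[ℂ] H) A ≤ fidelity (C : H →L[ℂ] H) B := by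
  refine ⟨fun h C => fidelity_mono _ h, fun h => (le_iff_re_inner_le A.2.1 B.2.1).2 fun x => ?_⟩
  have hx := h (pureState x)
  rw [show ((pureState x : densityOperators H) : H →L[ℂ] H) = dyad x from rfl,
    fidelity_dyad x A.2.1, fidelity_dyad x B.2.1,
    ENNReal.ofReal_le_ofReal_iff (Real.sqrt_nonneg _),
    Real.sqrt_le_sqrt_iff (re_inner_nonneg B.2.1 x)] at hx
  exact hx

/-- An operator below `|x⟩⟨x|` is a multiple of it. -/
lemma eq_smul_dyad_of_le {x : H} (hx : x ≠ 0) {A : H →L[ℂ] H} (hA : 0 ≤ A) (h : A ≤ dyad x) :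
    ∃ t : ℝ, A = (t : ℂ) • dyad x := by
  have hle := (le_iff_re_inner_le hA (dyad_nonneg x)).1 h
  -- `A` vanishes on the orthogonal complement of `x`, so it is determined by `A x`.
  have hker : ∀ y : H, ⟪x, y⟫_ℂ = 0 → A y = 0 := fun y hy => by
    refine apply_eq_zero hA (le_antisymm ?_ (re_inner_nonneg hA y))
    have := hle y
    rwa [re_inner_dyad, hy, norm_zero, zero_pow two_ne_zero] at this
  have hxx : ⟪x, x⟫_ℂ ≠ 0 := inner_self_ne_zero.2 hx
  have hAy : ∀ y, A y = (⟪x, y⟫_ℂ / ⟪x, x⟫_ℂ) • A x := fun y => by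
    have h0 : ⟪x, y - (⟪x, y⟫_ℂ / ⟪x, x⟫_ℂ) • x⟫_ℂ = 0 := by
      rw [inner_sub_right, inner_smul_right, div_mul_cancel₀ _ hxx, sub_self]
    have := hker _ h0
    rwa [map_sub, map_smul, sub_eq_zero] at this
  refine ⟨RCLike.re ⟪x, A x⟫_ℂ / (‖x‖ ^ 2) ^ 2, ?_⟩
  have hxx' : ⟪x, x⟫_ℂ = ((‖x‖ ^ 2 : ℝ) : ℂ) := by
    rw [inner_self_eq_norm_sq_to_K]; simp
  have hAx : A x = (⟪x, A x⟫_ℂ / ⟪x, x⟫_ℂ) • x := by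
    refine ext_inner_right ℂ fun y => ?_
    rw [inner_apply_symm hA, hAy y, inner_smul_right, inner_smul_left, map_div₀,
      ← ofReal_re_inner hA x, hxx']
    simp only [Complex.conj_ofReal]
    ring
  ext y
  rw [smul_apply, dyad_apply, Complex.ofReal_div, ofReal_re_inner hA, hAy y]
  conv_lhs => rw [hAx]
  rw [smul_smul, smul_smul, hxx']
  congr 1
  push_cast
  ring

lemma smul_dyad_le_total (x : H) (s t : ℝ) :
    (s : ℂ) • dyad x ≤ (t : ℂ) • dyad x ∨ (t : ℂ) • dyad x ≤ (s : ℂ) • dyad x := by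
  have key : ∀ s t : ℝ, s ≤ t → (s : ℂ) • dyad x ≤ (t : ℂ) • dyad x := fun s t h => by
    rw [← sub_nonneg, ← sub_smul, ← Complex.ofReal_sub,
      ofReal_smul_dyad (sub_nonneg.2 h)]
    exact dyad_nonneg _
  rcases le_total s t with h | h
  exacts [Or.inl (key _ _ h), Or.inr (key _ _ h)]

lemma pureState_chain {x : H} (hx : x ≠ 0) (B C : densityOperators H) (hB : B ≤ pureState x)
    (hC : C ≤ pureState x) : B ≤ C ∨ C ≤ B := by
  obtain ⟨s, hs⟩ := eq_smul_dyad_of_le hx B.2.1 hB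
  obtain ⟨t, ht⟩ := eq_smul_dyad_of_le hx C.2.1 hC
  have := smul_dyad_le_total x s t
  rwa [← hs, ← ht] at this

/-- A nonzero density operator such that the operators below it are linearly ordered has rank
one. -/
lemma exists_eq_pureState {A : densityOperators H} (hA0 : (A : H →L[ℂ] H) ≠ 0)
    (h : ∀ B C : densityOperators H, B ≤ A → C ≤ A → B ≤ C ∨ C ≤ B) :
    ∃ x : H, A = pureState x := by
  obtain ⟨A, hA, htr⟩ := A
  change A ≠ 0 at hA0
  obtain ⟨x, hx⟩ : ∃ x, A x ≠ 0 := by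
    by_contra! hcon
    exact hA0 (ContinuousLinearMap.ext hcon)
  -- normalization of `A y` making `|A y⟩⟨A y|` an operator below `A`
  let v : H → H := fun y => (((√(RCLike.re ⟪y, A y⟫_ℂ))⁻¹ : ℝ) : ℂ) • A y
  -- This is `norm_inner_sq_le` divided by `⟪y, A y⟫`; if that vanishes, `v y = 0` because `0⁻¹ =
  -- 0`.
  have hv : ∀ y, dyad (v y) ≤ A := fun y => by
    rw [le_iff_re_inner_le (dyad_nonneg _) hA]
    intro z
    rw [re_inner_dyad, inner_smul_left, norm_mul, mul_pow, Complex.conj_ofReal, Complex.norm_real,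
      Real.norm_eq_abs, sq_abs, inv_pow, Real.sq_sqrt (re_inner_nonneg hA y),
      inner_apply_symm hA]
    rcases (re_inner_nonneg hA y).eq_or_lt with h0 | h0
    · rw [← h0]; simpa using re_inner_nonneg hA z
    · rw [inv_mul_le_iff₀ h0]
      exact norm_inner_sq_le hA y z
  have hpos : ∀ y, A y ≠ 0 → 0 < RCLike.re ⟪y, A y⟫_ℂ := fun y hy =>
    lt_of_le_of_ne (re_inner_nonneg hA y) fun h0 => hy (apply_eq_zero hA h0.symm)
  have hperp : ∀ y z w, dyad (v y) ≤ dyad (v z) → ⟪A z, w⟫_ℂ = 0 → A y ≠ 0 → ⟪A y, w⟫_ℂ = 0 := by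
    intro y z w hle hz hy
    have h1 := (le_iff_re_inner_le (dyad_nonneg _) (dyad_nonneg _)).1 hle w
    rw [re_inner_dyad, re_inner_dyad, inner_smul_left, inner_smul_left, hz, mul_zero, norm_zero,
      zero_pow two_ne_zero] at h1
    have h2 : ‖(starRingEnd ℂ) (((√(RCLike.re ⟪y, A y⟫_ℂ))⁻¹ : ℝ) : ℂ) * ⟪A y, w⟫_ℂ‖ = 0 := by
      nlinarith [norm_nonneg ((starRingEnd ℂ) (((√(RCLike.re ⟪y, A y⟫_ℂ))⁻¹ : ℝ) : ℂ) * ⟪A y, w⟫_ℂ)]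
    rw [norm_eq_zero, Complex.conj_ofReal, mul_eq_zero, Complex.ofReal_eq_zero, inv_eq_zero] at h2
    exact h2.resolve_left (Real.sqrt_pos.2 (hpos y hy)).ne'
  have hpar : ∀ y z, A y ≠ 0 → dyad (v y) ≤ dyad (v z) → A z ≠ 0 → ∃ c : ℂ, A y = c • A z := by
    intro y z hy hle hz
    have hzz : ⟪A z, A z⟫_ℂ ≠ 0 := inner_self_ne_zero.2 hz
    refine ⟨⟪A z, A y⟫_ℂ / ⟪A z, A z⟫_ℂ, ?_⟩
    set w := A y - (⟪A z, A y⟫_ℂ / ⟪A z, A z⟫_ℂ) • A z with hw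
    have h1 : ⟪A z, w⟫_ℂ = 0 := by
      rw [hw, inner_sub_right, inner_smul_right, div_mul_cancel₀ _ hzz, sub_self]
    have h2 := hperp y z w hle h1 hy
    have h3 : ⟪w, w⟫_ℂ = 0 := by
      conv_lhs => rw [hw]
      rw [inner_sub_left, inner_smul_left, h1, h2, mul_zero, sub_zero]
    exact sub_eq_zero.1 (inner_self_eq_zero.1 h3)
  -- Comparable rank-one operators have parallel ranges, so the chain condition forces the range of
  -- `A` to be a line.
  have hall : ∀ y, ∃ c : ℂ, A y = c • A x := fun y => by
    by_cases hy : A y = 0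
    · exact ⟨0, by rw [hy, zero_smul]⟩
    rcases h (pureState (v y)) (pureState (v x)) (hv y) (hv x) with hle | hle
    · exact hpar y x hy hle hx
    · obtain ⟨c, hc⟩ := hpar x y hx hle hy
      have hc0 : c ≠ 0 := by
        rintro rfl
        exact hx (by rw [hc, zero_smul])
      exact ⟨c⁻¹, by rw [hc, smul_smul, inv_mul_cancel₀ hc0, one_smul]⟩
  refine ⟨v x, Subtype.ext ?_⟩
  change A = dyad (v x)
  ext y
  obtain ⟨c, hc⟩ := hall y
  have hxy : ⟪A x, y⟫_ℂ = c * ((RCLike.re ⟪x, A x⟫_ℂ : ℝ) : ℂ) := by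
    rw [inner_apply_symm hA, hc, inner_smul_right, ofReal_re_inner hA]
  have hp := hpos x hx
  rw [dyad_apply, inner_smul_left, smul_smul, hxy, Complex.conj_ofReal, hc]
  congr 1
  have hs : (((√(RCLike.re ⟪x, A x⟫_ℂ))⁻¹ : ℝ) : ℂ) * (((√(RCLike.re ⟪x, A x⟫_ℂ))⁻¹ : ℝ) : ℂ) *
      ((RCLike.re ⟪x, A x⟫_ℂ : ℝ) : ℂ) = 1 := by
    rw [← Complex.ofReal_mul, ← Complex.ofReal_mul, ← mul_inv, Real.mul_self_sqrt hp.le,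
      inv_mul_cancel₀ hp.ne', Complex.ofReal_one]
  linear_combination -c * hs

end Operators

/-! ### Wigner's theorem -/

section Wigner

variable {E F : Type*} [NormedAddCommGroup E] [InnerProductSpace ℂ E]
  [NormedAddCommGroup F] [InnerProductSpace ℂ F]

/-- Two vectors agree up to a phase. -/
def PhaseEq (x y : E) : Prop := ∃ c : ℂ, ‖c‖ = 1 ∧ x = c • y

lemma PhaseEq.norm_eq {x y : E} (h : PhaseEq x y) : ‖x‖ = ‖y‖ := by
  obtain ⟨c, hc, rfl⟩ := h
  rw [norm_smul, hc, one_mul]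

lemma PhaseEq.norm_inner_left {x y : E} (h : PhaseEq x y) (z : E) : ‖⟪x, z⟫_ℂ‖ = ‖⟪y, z⟫_ℂ‖ := by
  obtain ⟨c, hc, rfl⟩ := h
  rw [inner_smul_left, norm_mul, RCLike.norm_conj, hc, one_mul]

lemma PhaseEq.norm_inner_right {x y : E} (h : PhaseEq x y) (z : E) :
    ‖⟪z, x⟫_ℂ‖ = ‖⟪z, y⟫_ℂ‖ := by
  rw [norm_inner_symm, h.norm_inner_left, norm_inner_symm]

lemma PhaseEq.symm {x y : E} (h : PhaseEq x y) : PhaseEq y x := by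
  obtain ⟨c, hc, rfl⟩ := h
  have hc0 : c ≠ 0 := by rintro rfl; simp at hc
  exact ⟨c⁻¹, by rw [norm_inv, hc, inv_one], by rw [smul_smul, inv_mul_cancel₀ hc0, one_smul]⟩

lemma PhaseEq.trans {x y z : E} (h : PhaseEq x y) (h' : PhaseEq y z) : PhaseEq x z := by
  obtain ⟨c, hc, rfl⟩ := h
  obtain ⟨d, hd, rfl⟩ := h'
  exact ⟨c * d, by rw [norm_mul, hc, hd, one_mul], by rw [smul_smul]⟩

lemma phaseEq_smul_smul {a b : ℂ} (h : ‖a‖ = ‖b‖) (x : E) : PhaseEq (a • x) (b • x) := by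
  by_cases hb : b = 0
  · subst hb
    rw [norm_zero, norm_eq_zero] at h
    exact ⟨1, norm_one, by simp [h]⟩
  · exact ⟨a / b, by rw [norm_div, h, div_self (norm_ne_zero_iff.2 hb)],
      by rw [smul_smul, div_mul_cancel₀ _ hb]⟩

lemma PhaseEq.smul {x y : E} (h : PhaseEq x y) (a : ℂ) : PhaseEq (a • x) (a • y) := by
  obtain ⟨c, hc, rfl⟩ := h
  exact ⟨c, hc, smul_comm a c y⟩

/-- The equality case of the Cauchy-Schwarz inequality. -/
lemma phaseEq_of_norm_inner {x y : E} (hn : ‖x‖ = ‖y‖) (h : ‖⟪x, y⟫_ℂ‖ = ‖y‖ ^ 2) :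
    PhaseEq x y := by
  by_cases hy : y = 0
  · subst hy
    rw [norm_zero, norm_eq_zero] at hn
    exact ⟨1, norm_one, by simp [hn]⟩
  have hx : x ≠ 0 := by
    rintro rfl
    rw [norm_zero] at hn
    exact hy (norm_eq_zero.1 hn.symm)
  obtain ⟨r, -, hr⟩ := (norm_inner_eq_norm_iff hx hy).1 (by rw [h, hn, sq])
  refine PhaseEq.symm ⟨r, ?_, hr⟩
  have h1 := congrArg norm hr
  rw [norm_smul, hn] at h1
  have := norm_pos_iff.2 hy
  nlinarith

/-- Two complex numbers with the same modulus, also after adding one, have the same real part. -/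
lemma re_eq_of_norm_eq {z w : ℂ} (h : ‖z‖ = ‖w‖) (h1 : ‖1 + z‖ = ‖1 + w‖) : z.re = w.re := by
  have a := congrArg (· ^ 2) h
  have b := congrArg (· ^ 2) h1
  simp only [Complex.sq_norm, Complex.normSq_apply, Complex.add_re, Complex.add_im, Complex.one_re,
    Complex.one_im] at a b
  linarith

/-- A map on the orthogonal complement of `e` that preserves the real part and the modulus of the
inner product is additive, and linear or antilinear. -/
lemma exists_semilinear_of_re_inner (e : E) (U : E → F)
    (hre : ∀ x y, ⟪e, x⟫_ℂ = 0 → ⟪e, y⟫_ℂ = 0 → (⟪U x, U y⟫_ℂ).re = (⟪x, y⟫_ℂ).re)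
    (hno : ∀ x y, ⟪e, x⟫_ℂ = 0 → ⟪e, y⟫_ℂ = 0 → ‖⟪U x, U y⟫_ℂ‖ = ‖⟪x, y⟫_ℂ‖) :
    (∀ x y, ⟪e, x⟫_ℂ = 0 → ⟪e, y⟫_ℂ = 0 → U (x + y) = U x + U y) ∧
    ∃ σ : ℂ →+* ℂ, (σ = RingHom.id ℂ ∨ σ = starRingEnd ℂ) ∧
      ∀ (a : ℂ) (x : E), ⟪e, x⟫_ℂ = 0 → U (a • x) = σ a • U x := by
  have hE : ∀ x y, ⟪e, x⟫_ℂ = 0 → ⟪e, y⟫_ℂ = 0 → ⟪e, x + y⟫_ℂ = 0 := fun x y hx hy => by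
    rw [inner_add_right, hx, hy, add_zero]
  have hS : ∀ (a : ℂ) x, ⟪e, x⟫_ℂ = 0 → ⟪e, a • x⟫_ℂ = 0 := fun a x hx => by
    rw [inner_smul_right, hx, mul_zero]
  have hzero : ∀ w : F, (⟪w, w⟫_ℂ).re = 0 → w = 0 := fun w h => by
    have h' : ‖w‖ ^ 2 = 0 := by rw [← inner_self_eq_norm_sq (𝕜 := ℂ)]; exact h
    exact norm_eq_zero.1 (pow_eq_zero_iff two_ne_zero |>.1 h')
  have hnorm : ∀ x, ⟪e, x⟫_ℂ = 0 → ‖U x‖ = ‖x‖ := fun x hx => by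
    have h := hre x x hx hx
    have h1 : ‖U x‖ ^ 2 = ‖x‖ ^ 2 := by
      rw [← inner_self_eq_norm_sq (𝕜 := ℂ), ← inner_self_eq_norm_sq (𝕜 := ℂ)]; exact h
    exact (pow_left_inj₀ (norm_nonneg _) (norm_nonneg _) two_ne_zero).1 h1
  have hadd : ∀ x y, ⟪e, x⟫_ℂ = 0 → ⟪e, y⟫_ℂ = 0 → U (x + y) = U x + U y := fun x y hx hy => by
    rw [← sub_eq_zero]
    apply hzero
    -- The defect is real-orthogonal to every value `U z`, hence to itself, being a sum of such
    -- values up to sign.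
    have hk : ∀ z, ⟪e, z⟫_ℂ = 0 → (⟪U (x + y) - (U x + U y), U z⟫_ℂ).re = 0 := fun z hz => by
      rw [inner_sub_left, inner_add_left, Complex.sub_re, Complex.add_re,
        hre _ _ (hE x y hx hy) hz, hre _ _ hx hz, hre _ _ hy hz, inner_add_left, Complex.add_re,
        sub_self]
    rw [inner_sub_right, inner_add_right, Complex.sub_re, Complex.add_re, hk _ (hE x y hx hy),
      hk _ hx, hk _ hy]
    norm_num
  have hreal : ∀ (r : ℝ) x, ⟪e, x⟫_ℂ = 0 → U ((r : ℂ) • x) = (r : ℂ) • U x := fun r x hx => by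
    rw [← sub_eq_zero]
    apply hzero
    have hk : ∀ z, ⟪e, z⟫_ℂ = 0 → (⟪U ((r : ℂ) • x) - (r : ℂ) • U x, U z⟫_ℂ).re = 0 :=
      fun z hz => by
        rw [inner_sub_left, inner_smul_left, Complex.sub_re, hre _ _ (hS _ x hx) hz,
          inner_smul_left, Complex.conj_ofReal, Complex.re_ofReal_mul, Complex.re_ofReal_mul,
          hre _ _ hx hz, sub_self]
    rw [inner_sub_right, inner_smul_right, Complex.sub_re, Complex.re_ofReal_mul,
      hk _ (hS _ x hx), hk _ hx]
    norm_num
  -- `⟪U x, U (i x)⟫` has real part `0` and modulus `‖x‖²`, so it is `±i ‖x‖²`, and equality holds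
  -- in Cauchy-Schwarz.
  have hI : ∀ x, ⟪e, x⟫_ℂ = 0 →
      U (Complex.I • x) = Complex.I • U x ∨ U (Complex.I • x) = -(Complex.I • U x) := by
    intro x hx
    have hxx : ⟪x, x⟫_ℂ = ((‖x‖ ^ 2 : ℝ) : ℂ) := by rw [inner_self_eq_norm_sq_to_K]; simp
    have h1 := hre x (Complex.I • x) hx (hS _ x hx)
    have h2 := hno x (Complex.I • x) hx (hS _ x hx)
    rw [inner_smul_right, hxx] at h1 h2
    have h2' := congrArg (· ^ 2) h2
    rw [Complex.re_mul_ofReal, Complex.I_re, zero_mul] at h1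
    simp only [Complex.sq_norm, Complex.normSq_apply, h1, Complex.re_mul_ofReal,
      Complex.im_mul_ofReal, Complex.I_re, Complex.I_im] at h2'
    have h3 : (⟪U x, U (Complex.I • x)⟫_ℂ).im = ‖x‖ ^ 2 ∨
        (⟪U x, U (Complex.I • x)⟫_ℂ).im = -‖x‖ ^ 2 := by
      apply sq_eq_sq_iff_eq_or_eq_neg.1
      linarith
    have hii : RCLike.re ⟪Complex.I • U x, U (Complex.I • x)⟫_ℂ =
        (⟪U x, U (Complex.I • x)⟫_ℂ).im := by
      rw [inner_smul_left, Complex.conj_I]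
      simp
    have n1 : ‖Complex.I • U x‖ = ‖x‖ := by
      rw [norm_smul, Complex.norm_I, one_mul, hnorm x hx]
    have n2 : ‖U (Complex.I • x)‖ = ‖x‖ := by
      rw [hnorm _ (hS _ x hx), norm_smul, Complex.norm_I, one_mul]
    rcases h3 with h3 | h3
    · left
      have h4 := @norm_sub_sq ℂ _ _ _ _ (Complex.I • U x) (U (Complex.I • x))
      rw [hii, n1, n2, h3] at h4
      have h5 : ‖Complex.I • U x - U (Complex.I • x)‖ ^ 2 = 0 := by linarith
      exact (sub_eq_zero.1 (norm_eq_zero.1 (pow_eq_zero_iff two_ne_zero |>.1 h5))).symm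
    · right
      have h4 := @norm_add_sq ℂ _ _ _ _ (Complex.I • U x) (U (Complex.I • x))
      rw [hii, n1, n2, h3] at h4
      have h5 : ‖Complex.I • U x + U (Complex.I • x)‖ ^ 2 = 0 := by linarith
      exact eq_neg_of_add_eq_zero_right (norm_eq_zero.1 (pow_eq_zero_iff two_ne_zero |>.1 h5))
  have hdecomp : ∀ (a : ℂ) x, ⟪e, x⟫_ℂ = 0 →
      U (a • x) = (a.re : ℂ) • U x + (a.im : ℂ) • U (Complex.I • x) := fun a x hx => by
    conv_lhs => rw [← Complex.re_add_im a, add_smul, mul_smul]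
    rw [hadd _ _ (hS _ x hx) (hS _ _ (hS _ x hx)), hreal _ x hx, hreal _ _ (hS _ x hx)]
  refine ⟨hadd, ?_⟩
  -- The sign does not depend on the vector: opposite signs at `x` and `y` are incompatible with
  -- either sign at `x + y`.
  have hunif : (∀ x, ⟪e, x⟫_ℂ = 0 → U (Complex.I • x) = Complex.I • U x) ∨
      (∀ x, ⟪e, x⟫_ℂ = 0 → U (Complex.I • x) = -(Complex.I • U x)) := by
    by_contra! hcon
    obtain ⟨⟨x, hx, hx1⟩, ⟨y, hy, hy1⟩⟩ := hcon
    have hx2 := (hI x hx).resolve_left hx1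
    have hy2 := (hI y hy).resolve_right hy1
    have hs := hI (x + y) (hE x y hx hy)
    rw [smul_add, hadd _ _ (hS _ x hx) (hS _ y hy), hadd _ _ hx hy, hx2, hy2, smul_add] at hs
    rcases hs with hs | hs
    · have : -(Complex.I • U x) = Complex.I • U x := add_right_cancel hs
      exact hx1 (hx2.trans this)
    · rw [neg_add] at hs
      exact hy1 (hy2.trans (add_left_cancel hs))
  rcases hunif with h | h
  · refine ⟨RingHom.id ℂ, Or.inl rfl, fun a x hx => ?_⟩
    rw [hdecomp a x hx, h x hx, smul_smul, ← add_smul, Complex.re_add_im, RingHom.id_apply]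
  · refine ⟨starRingEnd ℂ, Or.inr rfl, fun a x hx => ?_⟩
    rw [hdecomp a x hx, h x hx, smul_neg, smul_smul, ← sub_eq_add_neg, ← sub_smul]
    congr 1
    apply Complex.ext <;> simp

/-- A reference vector `e` fixes the phases: for `x ⊥ e`, rotate `T (e + x)` so that its component
along `T e` is `T e` itself, and let `U x` be the rest. The moduli of both `⟪U x, U y⟫` and `1 + ⟪U
x, U y⟫` are then preserved, hence also the real part. -/
lemma exists_semilinear_phaseEq (T : E → F) (hT : ∀ x y, ‖⟪T x, T y⟫_ℂ‖ = ‖⟪x, y⟫_ℂ‖) {e : E}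
    (he : ‖e‖ = 1) :
    ∃ σ : ℂ →+* ℂ, (σ = RingHom.id ℂ ∨ σ = starRingEnd ℂ) ∧ ∃ W : E →ₛₗ[σ] F,
      ∀ x, PhaseEq (T x) (W x) := by
  have hN : ∀ x, ‖T x‖ = ‖x‖ := fun x => by
    have h := hT x x
    rw [inner_self_eq_norm_sq_to_K, inner_self_eq_norm_sq_to_K, norm_pow, norm_pow,
      RCLike.norm_ofReal, RCLike.norm_ofReal, abs_norm, abs_norm] at h
    exact (pow_left_inj₀ (norm_nonneg _) (norm_nonneg _) two_ne_zero).1 h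
  have hTsmul : ∀ (a : ℂ) x, PhaseEq (T (a • x)) (a • T x) := fun a x => by
    refine phaseEq_of_norm_inner (by rw [hN, norm_smul, norm_smul, hN]) ?_
    rw [inner_smul_right, norm_mul, hT, inner_smul_left, norm_mul, RCLike.norm_conj,
      inner_self_eq_norm_sq_to_K, norm_pow, RCLike.norm_ofReal, abs_norm, norm_smul, hN]
    ring
  have hee : ⟪e, e⟫_ℂ = 1 := by rw [inner_self_eq_norm_sq_to_K, he]; simp
  have hff : ⟪T e, T e⟫_ℂ = 1 := by rw [inner_self_eq_norm_sq_to_K, hN, he]; simp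
  have hU : ∀ x, ∃ u : F, ⟪e, x⟫_ℂ = 0 → ⟪T e, u⟫_ℂ = 0 ∧ PhaseEq (T e + u) (T (e + x)) := by
    intro x
    by_cases hx : ⟪e, x⟫_ℂ = 0
    · have h1 : ‖⟪T e, T (e + x)⟫_ℂ‖ = 1 := by
        rw [hT, inner_add_right, hee, hx, add_zero, norm_one]
      have h0 : ⟪T e, T (e + x)⟫_ℂ ≠ 0 := by rw [← norm_ne_zero_iff, h1]; exact one_ne_zero
      refine ⟨(⟪T e, T (e + x)⟫_ℂ)⁻¹ • T (e + x) - T e, fun _ =>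
        ⟨?_, (⟪T e, T (e + x)⟫_ℂ)⁻¹, ?_, ?_⟩⟩
      · rw [inner_sub_right, inner_smul_right, inv_mul_cancel₀ h0, hff, sub_self]
      · rw [norm_inv, h1, inv_one]
      · rw [add_sub_cancel]
    · exact ⟨0, fun h => absurd h hx⟩
  choose U hU using hU
  have hone : ∀ x y, ⟪e, x⟫_ℂ = 0 → ⟪e, y⟫_ℂ = 0 → ‖1 + ⟪U x, U y⟫_ℂ‖ = ‖1 + ⟪x, y⟫_ℂ‖ := by
    intro x y hx hy
    have h := hT (e + x) (e + y)
    have h1 : ⟪U x, T e⟫_ℂ = 0 := inner_eq_zero_symm.1 (hU x hx).1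
    have h2 : ⟪x, e⟫_ℂ = 0 := inner_eq_zero_symm.1 hx
    rw [← (hU x hx).2.norm_inner_left, ← (hU y hy).2.norm_inner_right] at h
    simpa only [inner_add_left, inner_add_right, hee, hff, hx, hy, h1, h2, (hU y hy).1, add_zero,
      zero_add] using h
  have hUn : ∀ x, ⟪e, x⟫_ℂ = 0 → ‖U x‖ = ‖x‖ := by
    intro x hx
    have h := hone x x hx hx
    rw [inner_self_eq_norm_sq_to_K, inner_self_eq_norm_sq_to_K] at h
    have h' : ∀ t : ℝ, ‖(1 : ℂ) + ((t : ℝ) : ℂ) ^ 2‖ = 1 + t ^ 2 := fun t => by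
      rw [← Complex.ofReal_pow, ← Complex.ofReal_one, ← Complex.ofReal_add, Complex.norm_real,
        Real.norm_of_nonneg (by positivity)]
    have h2 : 1 + ‖U x‖ ^ 2 = 1 + ‖x‖ ^ 2 := (h' _).symm.trans (h.trans (h' _))
    exact (pow_left_inj₀ (norm_nonneg _) (norm_nonneg _) two_ne_zero).1 (add_left_cancel h2)
  have hUT : ∀ x, ⟪e, x⟫_ℂ = 0 → PhaseEq (T x) (U x) := by
    intro x hx
    refine phaseEq_of_norm_inner (by rw [hN, hUn x hx]) ?_
    have h1 : ⟪T x, T e⟫_ℂ = 0 := by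
      rw [← norm_eq_zero, hT, norm_inner_symm, hx, norm_zero]
    have h2 := hT x (e + x)
    rw [← (hU x hx).2.norm_inner_right, inner_add_right, inner_add_right, h1, zero_add,
      ← inner_conj_symm x e, hx, map_zero, zero_add, inner_self_eq_norm_sq_to_K, norm_pow,
      RCLike.norm_ofReal, abs_norm] at h2
    rw [h2, hUn x hx]
  have hno : ∀ x y, ⟪e, x⟫_ℂ = 0 → ⟪e, y⟫_ℂ = 0 → ‖⟪U x, U y⟫_ℂ‖ = ‖⟪x, y⟫_ℂ‖ :=
    fun x y hx hy => by
      rw [← (hUT x hx).norm_inner_left, ← (hUT y hy).norm_inner_right, hT]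
  obtain ⟨hadd, σ, hσ, hsm⟩ := exists_semilinear_of_re_inner e U
    (fun x y hx hy => re_eq_of_norm_eq (hno x y hx hy) (hone x y hx hy)) hno
  have hσn : ∀ a, ‖σ a‖ = ‖a‖ := by
    rcases hσ with rfl | rfl <;> simp
  have hp : ∀ x, ⟪e, x - ⟪e, x⟫_ℂ • e⟫_ℂ = 0 := fun x => by
    rw [inner_sub_right, inner_smul_right, hee, mul_one, sub_self]
  let W : E →ₛₗ[σ] F :=
    { toFun := fun x => σ ⟪e, x⟫_ℂ • T e + U (x - ⟪e, x⟫_ℂ • e)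
      map_add' := fun x y => by
        rw [inner_add_right, map_add, add_smul, add_smul, add_sub_add_comm,
          hadd _ _ (hp x) (hp y)]
        abel
      map_smul' := fun a x => by
        rw [inner_smul_right, map_mul, mul_smul, mul_smul, ← smul_sub, hsm _ _ (hp x), smul_add] }
  refine ⟨σ, hσ, W, fun x => ?_⟩
  change PhaseEq (T x) (σ ⟪e, x⟫_ℂ • T e + U (x - ⟪e, x⟫_ℂ • e))
  by_cases ha : ⟪e, x⟫_ℂ = 0
  · rw [ha, map_zero, zero_smul, zero_smul, zero_add, sub_zero]
    exact hUT x ha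
  have hpx := hp x
  set a := ⟪e, x⟫_ℂ
  -- Scaling the `e`-component to `1` reduces to the vectors `e + x'`, `x' ⊥ e`, that define `U`.
  have hx : x = a • (e + a⁻¹ • (x - a • e)) := by
    rw [smul_add, smul_smul, mul_inv_cancel₀ ha, one_smul, add_sub_cancel]
  have hq : ⟪e, a⁻¹ • (x - a • e)⟫_ℂ = 0 := by rw [inner_smul_right, hpx, mul_zero]
  have hs : σ a • (T e + U (a⁻¹ • (x - a • e))) = σ a • T e + U (x - a • e) := by
    have hσa : σ a ≠ 0 := by rwa [← norm_ne_zero_iff, hσn, norm_ne_zero_iff]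
    rw [hsm _ _ hpx, smul_add, smul_smul, map_inv₀, mul_inv_cancel₀ hσa, one_smul]
  rw [← hs]
  have h1 : PhaseEq (T x) (a • T (e + a⁻¹ • (x - a • e))) := by
    conv_lhs => rw [hx]
    exact hTsmul _ _
  exact (h1.trans ((hU _ hq).2.symm.smul a)).trans (phaseEq_smul_smul (hσn a).symm _)

/-- **Wigner's theorem** on symmetry transformations, for maps that are surjective up to phases. -/
theorem exists_isometryEquiv_phaseEq (T : E → F) (hT : ∀ x y, ‖⟪T x, T y⟫_ℂ‖ = ‖⟪x, y⟫_ℂ‖)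
    (hs : ∀ y, ∃ x, PhaseEq y (T x)) :
    (∃ U : E ≃ₗᵢ[ℂ] F, ∀ x, PhaseEq (T x) (U x)) ∨
      (∃ V : E ≃ₗᵢ⋆[ℂ] F, ∀ x, PhaseEq (T x) (V x)) := by
  have hN : ∀ x, ‖T x‖ = ‖x‖ := fun x => by
    have h := hT x x
    rw [inner_self_eq_norm_sq_to_K, inner_self_eq_norm_sq_to_K, norm_pow, norm_pow,
      RCLike.norm_ofReal, RCLike.norm_ofReal, abs_norm, abs_norm] at h
    exact (pow_left_inj₀ (norm_nonneg _) (norm_nonneg _) two_ne_zero).1 h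
  -- The range of a semilinear map absorbs phases, so surjectivity up to phases becomes
  -- surjectivity.
  have hlin : ∀ σ : ℂ →+* ℂ, Function.Surjective σ → ∀ W : E →ₛₗ[σ] F,
      (∀ x, PhaseEq (T x) (W x)) → (∀ x, ‖W x‖ = ‖x‖) ∧ Function.Surjective W := by
    intro σ hσ W hW
    refine ⟨fun x => (hW x).norm_eq.symm.trans (hN x), fun y => ?_⟩
    obtain ⟨x, hx⟩ := hs y
    obtain ⟨c, -, hc⟩ := hx.trans (hW x)
    obtain ⟨d, hd⟩ := hσ c
    exact ⟨d • x, by rw [map_smulₛₗ, hd, hc]⟩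
  by_cases he : ∃ e : E, ‖e‖ = 1
  · obtain ⟨e, he⟩ := he
    obtain ⟨σ, rfl | rfl, W, hW⟩ := exists_semilinear_phaseEq T hT he
    · obtain ⟨h1, h2⟩ := hlin _ Function.surjective_id W hW
      exact Or.inl ⟨LinearIsometryEquiv.ofSurjective ⟨W, h1⟩ h2, hW⟩
    · obtain ⟨h1, h2⟩ := hlin _ (starRingAut (R := ℂ)).surjective W hW
      exact Or.inr ⟨LinearIsometryEquiv.ofSurjective ⟨W, h1⟩ h2, hW⟩
  -- Without unit vectors `E = 0`, and the zero map serves as the isometry.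
  · have h0 : ∀ x : E, x = 0 := fun x => by
      by_contra hx
      exact he ⟨((‖x‖ : ℂ)⁻¹) • x, by
        rw [norm_smul, norm_inv, Complex.norm_real, norm_norm,
          inv_mul_cancel₀ (norm_ne_zero_iff.2 hx)]⟩
    have hW : ∀ x, PhaseEq (T x) ((0 : E →ₗ[ℂ] F) x) := fun x =>
      ⟨1, norm_one, by
        rw [LinearMap.zero_apply, smul_zero, ← norm_eq_zero, hN, h0 x, norm_zero]⟩
    obtain ⟨h1, h2⟩ := hlin _ Function.surjective_id _ hW
    exact Or.inl ⟨LinearIsometryEquiv.ofSurjective ⟨0, h1⟩ h2, hW⟩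

end Wigner

/-! ### Order automorphisms and rank-one operators -/

section Preservers

variable {H : Type*} [NormedAddCommGroup H] [InnerProductSpace ℂ H] [CompleteSpace H]

lemma coe_eq_zero_iff_forall_le (A : densityOperators H) :
    (A : H →L[ℂ] H) = 0 ↔ ∀ B, A ≤ B := by
  refine ⟨fun h B => ?_, fun h => le_antisymm ?_ A.2.1⟩
  · change (A : H →L[ℂ] H) ≤ B
    rw [h]
    exact B.2.1
  · have h0 : dyad (0 : H) = 0 := by ext; simp [dyad_apply]
    rw [← h0]
    exact h (pureState 0)

/-- Being zero (least) and having a totally ordered set below are order-theoretic properties, so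
both are transported by `e`. -/
lemma exists_orderIso_apply_pureState (e : densityOperators H ≃o densityOperators H) (x : H) :
    ∃ y, e (pureState x) = pureState y := by
  by_cases hx : x = 0
  · subst hx
    have h0 : dyad (0 : H) = 0 := by ext; simp [dyad_apply]
    refine ⟨0, Subtype.ext ?_⟩
    change _ = dyad (0 : H)
    rw [h0, coe_eq_zero_iff_forall_le]
    intro B
    rw [← e.le_symm_apply]
    exact (coe_eq_zero_iff_forall_le _).1 h0 _
  · refine exists_eq_pureState (fun h => dyad_ne_zero hx ?_) fun B C hB hC => ?_
    · rw [coe_eq_zero_iff_forall_le] at h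
      exact (coe_eq_zero_iff_forall_le (pureState x)).2 fun B => e.le_iff_le.1 (h _)
    · rw [← e.symm_apply_le] at hB hC
      exact (pureState_chain hx _ _ hB hC).imp e.symm.le_iff_le.1 e.symm.le_iff_le.1

lemma phaseEq_of_pureState_eq {x y : H} (h : pureState x = pureState y) : PhaseEq x y := by
  have hd : dyad x = dyad y := congrArg Subtype.val h
  have hz : ∀ z, ‖⟪x, z⟫_ℂ‖ = ‖⟪y, z⟫_ℂ‖ := fun z => by
    have h1 := re_inner_dyad x z
    rw [hd, re_inner_dyad] at h1
    exact ((pow_left_inj₀ (norm_nonneg _) (norm_nonneg _) two_ne_zero).1 h1).symm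
  have hself : ∀ z : H, ‖⟪z, z⟫_ℂ‖ = ‖z‖ ^ 2 := fun z => by
    rw [inner_self_eq_norm_sq_to_K, norm_pow, RCLike.norm_ofReal, abs_norm]
  have h1 := hz x
  have h2 := hz y
  rw [hself] at h1 h2
  rw [norm_inner_symm, h2] at h1
  exact phaseEq_of_norm_inner
    ((pow_left_inj₀ (norm_nonneg _) (norm_nonneg _) two_ne_zero).1 h1) h2

lemma PhaseEq.inner_apply_self {x y : H} (h : PhaseEq x y) (A : H →L[ℂ] H) :
    ⟪x, A x⟫_ℂ = ⟪y, A y⟫_ℂ := by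
  obtain ⟨c, hc, rfl⟩ := h
  rw [map_smul, inner_smul_left, inner_smul_right, ← mul_assoc, Complex.conj_mul', hc]
  simp

/-- Complex polarization; it lets the final comparison ignore the phases relating `T` to the
isometry. -/
lemma eq_of_inner_self_eq (A B : H →ₗ[ℂ] H) (h : ∀ z, ⟪z, A z⟫_ℂ = ⟪z, B z⟫_ℂ) : A = B := by
  rw [← sub_eq_zero, ← inner_map_self_eq_zero]
  intro z
  rw [inner_eq_zero_symm, LinearMap.sub_apply, inner_sub_right, h, sub_self]

end Preservers

end FidelityPreserving

end

open FidelityPreserving in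
theorem theorem1 {H : Type*} [NormedAddCommGroup H] [InnerProductSpace ℂ H] [CompleteSpace H]
    (φ : FidelityPreserving.densityOperators H → FidelityPreserving.densityOperators H)
    (hφ : Function.Bijective φ)
    (hF : ∀ A B : FidelityPreserving.densityOperators H,
      FidelityPreserving.fidelity (φ A : H →L[ℂ] H) (φ B : H →L[ℂ] H) =
        FidelityPreserving.fidelity (A : H →L[ℂ] H) (B : H →L[ℂ] H)) :
    (∃ U : H ≃ₗᵢ[ℂ] H, ∀ (A : FidelityPreserving.densityOperators H) (x : H),
        (φ A : H →L[ℂ] H) x = U ((A : H →L[ℂ] H) (U.symm x))) ∨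
    (∃ V : H ≃ₗᵢ⋆[ℂ] H, ∀ (A : FidelityPreserving.densityOperators H) (x : H),
        (φ A : H →L[ℂ] H) x = V ((A : H →L[ℂ] H) (V.symm x))) := by
  let e : densityOperators H ≃o densityOperators H :=
    { Equiv.ofBijective φ hφ with
      map_rel_iff' := fun {A B} => by
        change φ A ≤ φ B ↔ A ≤ B
        -- By surjectivity the test operators on the image side may be taken of the form `φ C`.
        rw [le_iff_fidelity_le, le_iff_fidelity_le, hφ.2.forall]
        simp only [hF] }
  have he : ∀ A, e A = φ A := fun A => rfl
  choose T hT using exists_orderIso_apply_pureState e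
  have hq : ∀ (A : densityOperators H) x,
      ⟪T x, (φ A : H →L[ℂ] H) (T x)⟫_ℂ = ⟪x, (A : H →L[ℂ] H) x⟫_ℂ := fun A x => by
    have h := hF (pureState x) A
    rw [← he, hT] at h
    change fidelity (dyad (T x)) _ = fidelity (dyad x) _ at h
    rw [fidelity_dyad _ (φ A).2.1, fidelity_dyad _ A.2.1,
      ENNReal.ofReal_eq_ofReal_iff (Real.sqrt_nonneg _) (Real.sqrt_nonneg _),
      Real.sqrt_inj (re_inner_nonneg (φ A).2.1 _) (re_inner_nonneg A.2.1 _)] at h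
    rw [← ofReal_re_inner (φ A).2.1, ← ofReal_re_inner A.2.1, h]
  have hTi : ∀ x y, ‖⟪T x, T y⟫_ℂ‖ = ‖⟪x, y⟫_ℂ‖ := fun x y => by
    have h := congrArg RCLike.re (hq (pureState x) y)
    rw [← he, hT] at h
    change RCLike.re ⟪T y, dyad (T x) (T y)⟫_ℂ = RCLike.re ⟪y, dyad x y⟫_ℂ at h
    rw [re_inner_dyad, re_inner_dyad] at h
    exact (pow_left_inj₀ (norm_nonneg _) (norm_nonneg _) two_ne_zero).1 h
  -- The inverse automorphism also preserves rank-one operators, and `dyad` determines its vector up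
  -- to phase.
  have hTs : ∀ y, ∃ x, PhaseEq y (T x) := fun y => by
    obtain ⟨x, hx⟩ := exists_orderIso_apply_pureState e.symm y
    refine ⟨x, phaseEq_of_pureState_eq ?_⟩
    rw [← hT, ← hx, e.apply_symm_apply]
  refine (exists_isometryEquiv_phaseEq T hTi hTs).imp ?_ ?_
  · rintro ⟨U, hU⟩
    refine ⟨U, fun A x => ?_⟩
    let B : H →ₗ[ℂ] H :=
      { toFun := fun z => U ((A : H →L[ℂ] H) (U.symm z))
        map_add' := fun z w => by simp only [map_add]
        map_smul' := fun c z => by simp only [map_smul, RingHom.id_apply] }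
    refine LinearMap.congr_fun (eq_of_inner_self_eq ((φ A : H →L[ℂ] H) : H →ₗ[ℂ] H) B
      fun z => ?_) x
    obtain ⟨y, rfl⟩ := U.surjective z
    change ⟪U y, (φ A : H →L[ℂ] H) (U y)⟫_ℂ = ⟪U y, U ((A : H →L[ℂ] H) (U.symm (U y)))⟫_ℂ
    rw [← (hU y).inner_apply_self, hq, U.symm_apply_apply, U.inner_map_map]
  · rintro ⟨V, hV⟩
    refine ⟨V, fun A x => ?_⟩
    let B : H →ₗ[ℂ] H :=
      { toFun := fun z => V ((A : H →L[ℂ] H) (V.symm z))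
        map_add' := fun z w => by simp only [map_add]
        map_smul' := fun c z => by
          simp only [map_smulₛₗ, RingHom.id_apply, Complex.conj_conj] }
    refine LinearMap.congr_fun (eq_of_inner_self_eq ((φ A : H →L[ℂ] H) : H →ₗ[ℂ] H) B
      fun z => ?_) x
    obtain ⟨y, rfl⟩ := V.surjective z
    change ⟪V y, (φ A : H →L[ℂ] H) (V y)⟫_ℂ = ⟪V y, V ((A : H →L[ℂ] H) (V.symm (V y)))⟫_ℂ
    -- The conjugation introduced by `V` is harmless because `⟪y, A y⟫` is real.
    rw [← (hV y).inner_apply_self, hq, V.symm_apply_apply, inner_antiunitary_apply_left,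
      V.symm_apply_apply, ← ofReal_re_inner A.2.1, Complex.conj_ofReal]
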